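/- For a nonzero $u\in\mathbb{R}^d$ let $R(u)=I-\frac{2}{\|u\|^2}uu^\top$ be the reflection in the hyperplane $u^\perp$. A reflection group in $\mathrm{O}(d)$ is a subgroup generated by a set of such reflections; it is essential if the origin is its only fixed point, and irreducible if it is not the direct product of two nontrivial reflection groups in $\mathrm{O}(d)$. For a finite reflection group $G\le\mathrm{O}(d)$, a Weyl chamber is a connected component of the complement of the union of the hyperplanes fixed by the reflections in $G$. The fundamental system of $G$ corresponding to a Weyl chamber $C$ consists of unit vectors $\alpha_1,\dots,\alpha_\ell$ with $R(\alpha_i)\in G$ and $\partial C\subseteq\bigcup_i\alpha_i^\perp$, where $\ell$ is the least number of hyperplanes of reflections in $G$ that cover $\partial C$, and where the signs are chosen so that $\langle\alpha_i,x\rangle\ge 0$ for all $x\in C$. Let $d\ge 1$, let $G\le\mathrm{O}(d)$ be an essential and irreducible finite reflection group, and let $A\in\mathbb{R}^{d\times d}$ be any matrix whose rows are unit vectors that form a fundamental system of $G$ (corresponding to some Weyl chamber, in some order). Put $M:=AA^\top-I_d$, and for $j\in\{1,\dots,d\}$ let $M^{(j)}$ be the principal submatrix of $M$ obtained by discarding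 the $j$th row and column. Let $\lambda_k(\cdot)$ denote the $k$th largest eigenvalue of a real symmetric matrix, counted with multiplicity. Then: (a) If $v$ and $w$ are any unit eigenvectors of $AA^\top$ for its largest eigenvalue $\lambda_1(AA^\top)$ and its smallest eigenvalue $\lambda_d(AA^\top)$, respectively, then $v_i^2=w_i^2$ for all $i\in\{1,\dots,d\}$. (b) $\lambda_{d-k+1}(M)=-\lambda_k(M)$ for all $k\in\{1,\dots,d\}$. (c) $\lambda_{d-k}(M^{(j)})=-\lambda_k(M^{(j)})$ for all $j\in\{1,\dots,d\}$ and $k\in\{1,\dots,d-1\}$. -/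

import Mathlib

open scoped RealInnerProductSpace

namespace ReflGroup

/-- Real `d`-dimensional Euclidean space. -/
abbrev E (d : ℕ) : Type := EuclideanSpace ℝ (Fin d)

/-- The orthogonal group `O(d)`, as the group of linear isometries of Euclidean space. -/
abbrev O (d : ℕ) : Type := E d ≃ₗᵢ[ℝ] E d

variable {d : ℕ}

/-- The hyperplane orthogonal to `u`. -/
noncomputable def hyperplane (u : E d) : Submodule ℝ (E d) := (Submodule.span ℝ {u})ᗮ

/-- The reflection `R(u) = I - 2 u uᵀ / ‖u‖²` in the hyperplane orthogonal to `u` (for `u ≠ 0`). -/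
noncomputable def R (u : E d) : O d := (Submodule.span ℝ {u})ᗮ.reflection

/-- A reflection is a transformation of the form `R(u)` with `u ≠ 0`. -/
def IsReflection (g : O d) : Prop := ∃ u : E d, u ≠ 0 ∧ g = R u

/-- A reflection group is a group generated by a set of reflections. -/
def IsReflectionGroup (G : Subgroup (O d)) : Prop :=
  ∃ S : Set (O d), (∀ s ∈ S, IsReflection s) ∧ Subgroup.closure S = G

/-- A group is essential if the origin is its only fixed point. -/
def IsEssential (G : Subgroup (O d)) : Prop :=
  ∀ x : E d, (∀ g ∈ G, g x = x) → x = 0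

/-- A reflection group is reducible if it is the (internal) direct product of two nontrivial
reflection groups in `O(d)`. -/
def IsReducible (G : Subgroup (O d)) : Prop :=
  ∃ H K : Subgroup (O d),
    IsReflectionGroup H ∧ IsReflectionGroup K ∧ H ≠ ⊥ ∧ K ≠ ⊥ ∧
    (∀ h ∈ H, ∀ k ∈ K, h * k = k * h) ∧ H ⊓ K = ⊥ ∧ H ⊔ K = G

/-- The union of the hyperplanes that are fixed by the individual reflections in `G`. -/
def mirrors (G : Subgroup (O d)) : Set (E d) :=
  {x | ∃ g ∈ G, IsReflection g ∧ g x = x}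

/-- The Weyl chambers of `G` are the connected components of the complement of the mirrors. -/
def IsWeylChamber (G : Subgroup (O d)) (C : Set (E d)) : Prop :=
  ∃ x ∈ (mirrors G)ᶜ, C = connectedComponentIn (mirrors G)ᶜ x

/-- The unit vectors `u 1, …, u m` have reflections in `G`, and their hyperplanes cover the
boundary of `C`. -/
def CoversBoundary (G : Subgroup (O d)) (C : Set (E d)) {m : ℕ} (u : Fin m → E d) : Prop :=
  (∀ i, ‖u i‖ = 1) ∧ (∀ i, R (u i) ∈ G) ∧ frontier C ⊆ ⋃ i, (hyperplane (u i) : Set (E d))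

/-- `α 1, …, α m` is the fundamental system of `G` corresponding to the chamber `C`: unit vectors
with reflections in `G` whose hyperplanes cover the boundary of `C` (and no fewer than `m`
hyperplanes do), signed so that they lie in the dual cone of `C`. -/
def IsFundamentalSystemOf (G : Subgroup (O d)) (C : Set (E d)) {m : ℕ} (α : Fin m → E d) : Prop :=
  CoversBoundary G C α ∧
  (∀ (k : ℕ) (u : Fin k → E d), CoversBoundary G C u → m ≤ k) ∧
  (∀ i, ∀ x ∈ C, 0 ≤ ⟪α i, x⟫)

/-- A fundamental system of `G` is one that corresponds to some Weyl chamber. -/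
def IsFundamentalSystem (G : Subgroup (O d)) {m : ℕ} (α : Fin m → E d) : Prop :=
  ∃ C, IsWeylChamber G C ∧ IsFundamentalSystemOf G C α

/-- The `i`-th row of a matrix, as a Euclidean vector. -/
noncomputable def row {m : ℕ} (A : Matrix (Fin m) (Fin d) ℝ) (i : Fin m) : E d :=
  WithLp.toLp 2 (A i)

/-- The Gram matrix `A Aᵀ` of the rows of `A`. -/
def gram (A : Matrix (Fin d) (Fin d) ℝ) : Matrix (Fin d) (Fin d) ℝ := A * A.transpose

/-- The matrix `M = A Aᵀ - I`. -/
def M (A : Matrix (Fin d) (Fin d) ℝ) : Matrix (Fin d) (Fin d) ℝ := gram A - 1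

/-- The principal submatrix obtained by discarding the `j`-th row and column. -/
def minor {n : ℕ} (B : Matrix (Fin (n + 1)) (Fin (n + 1)) ℝ) (j : Fin (n + 1)) :
    Matrix (Fin n) (Fin n) ℝ :=
  B.submatrix j.succAbove j.succAbove

/-- The eigenvalues of a real symmetric matrix in decreasing order, counted with multiplicity;
the largest one has index `0`. -/
noncomputable def eig {n : ℕ} {B : Matrix (Fin n) (Fin n) ℝ} (hB : B.IsHermitian) (k : Fin n) : ℝ :=
  hB.eigenvalues₀ (Fin.cast (Fintype.card_fin n).symm k)

theorem gram_isHermitian (A : Matrix (Fin d) (Fin d) ℝ) : (gram A).IsHermitian := by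
  simpa [gram] using Matrix.isHermitian_mul_conjTranspose_self A

theorem M_isHermitian (A : Matrix (Fin d) (Fin d) ℝ) : (M A).IsHermitian :=
  (gram_isHermitian A).sub Matrix.isHermitian_one

theorem minor_isHermitian {n : ℕ} {B : Matrix (Fin (n + 1)) (Fin (n + 1)) ℝ}
    (hB : B.IsHermitian) (j : Fin (n + 1)) : (minor B j).IsHermitian :=
  hB.submatrix _

end ReflGroup

/-! Everything follows from one diagonal sign matrix. A root in the span of two simple roots cannot
have coefficients of opposite sign (`coeff_mul_nonneg`); applied to reflected simple roots, this
makes each off-diagonal entry of `A Aᵀ` either 0 or at most -1/2. Each nonempty principal submatrix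
of `A Aᵀ` has positive entry sum, the squared norm of a nonzero sum of simple roots. So every
nonempty set of indices contains one with at most one neighbour in it: the Coxeter graph is a
forest, hence two-colourable (`exists_sign_of_sum_sum_pos`).

With D the diagonal matrix of the colours ±1, D(A Aᵀ)D = 2I - A Aᵀ and DMD = -M, and the latter
restricts to principal submatrices. Similarity gives (b) and (c). For (a), D carries top
eigenvectors of `A Aᵀ` to bottom ones, and the bottom eigenspace is a line by Perron–Frobenius. The
irreducibility this needs holds because the simple reflections generate G (`closure_eq`): an
orthogonal splitting of the simple roots would split G. -/

namespace ReflGroup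

/-! ### Spectra of symmetric matrices under similarity and affine change -/

section Spectrum

open Matrix Polynomial

variable {n : ℕ} {B : Matrix (Fin n) (Fin n) ℝ}

theorem smul_one_add_smul_eq_conj (hB : B.IsHermitian) (a b : ℝ) :
    a • 1 + b • B = (hB.eigenvectorUnitary : Matrix (Fin n) (Fin n) ℝ) *
      diagonal (fun i => a + b * hB.eigenvalues i) *
        star (hB.eigenvectorUnitary : Matrix (Fin n) (Fin n) ℝ) := by
  have hd : diagonal (fun i => a + b * hB.eigenvalues i) =
      a • (1 : Matrix (Fin n) (Fin n) ℝ) + b • diagonal hB.eigenvalues := by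
    ext i j
    by_cases h : i = j <;> simp [h, diagonal, one_apply]
  have hs := hB.spectral_theorem
  rw [Unitary.conjStarAlgAut_apply] at hs
  have hu : (hB.eigenvectorUnitary : Matrix (Fin n) (Fin n) ℝ) *
      star (hB.eigenvectorUnitary : Matrix (Fin n) (Fin n) ℝ) = 1 :=
    Unitary.mul_star_self_of_mem hB.eigenvectorUnitary.2
  rw [hd, mul_add, add_mul, mul_smul_comm, mul_smul_comm, mul_one, smul_mul_assoc,
    smul_mul_assoc, hu]
  congr 2

theorem charpoly_smul_one_add_smul (hB : B.IsHermitian) (a b : ℝ) :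
    (a • 1 + b • B).charpoly = ∏ i, (X - C (a + b * hB.eigenvalues i)) := by
  have hu : star (hB.eigenvectorUnitary : Matrix (Fin n) (Fin n) ℝ) *
      (hB.eigenvectorUnitary : Matrix (Fin n) (Fin n) ℝ) = 1 :=
    Unitary.star_mul_self_of_mem hB.eigenvectorUnitary.2
  rw [smul_one_add_smul_eq_conj hB, charpoly_mul_comm, ← mul_assoc, hu, one_mul,
    charpoly_diagonal]

theorem roots_charpoly_eq_map_eig (hB : B.IsHermitian) :
    B.charpoly.roots = Finset.univ.val.map (eig hB) := by
  have h : Finset.univ.val.map (finCongr (Fintype.card_fin n).symm) = Finset.univ.val :=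
    congrArg Finset.val (Finset.map_univ_equiv (finCongr (Fintype.card_fin n).symm))
  rw [hB.roots_charpoly_eq_eigenvalues₀, ← h, Multiset.map_map]
  rfl

theorem eig_antitone (hB : B.IsHermitian) : Antitone (eig hB) :=
  fun _ _ h => hB.eigenvalues₀_antitone h

theorem map_eigenvalues_eq_map_eig (hB : B.IsHermitian) :
    Finset.univ.val.map hB.eigenvalues = Finset.univ.val.map (eig hB) := by
  rw [← roots_charpoly_eq_map_eig, hB.roots_charpoly_eq_eigenvalues]
  rfl

theorem Antitone.eq_of_map_univ_eq {f g : Fin n → ℝ} (hf : Antitone f) (hg : Antitone g)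
    (h : Finset.univ.val.map f = Finset.univ.val.map g) : f = g := by
  rw [Fin.univ_val_map, Fin.univ_val_map, Multiset.coe_eq_coe] at h
  exact List.ofFn_injective (h.eq_of_sortedGE hf.sortedGE_ofFn hg.sortedGE_ofFn)

/-- If `B` is orthogonally similar to `c - B` via an involution, its spectrum is symmetric
about `c / 2`. -/
theorem eig_rev_of_conj_eq (hB : B.IsHermitian) {D : Matrix (Fin n) (Fin n) ℝ} {c : ℝ}
    (hD : D * D = 1) (h : D * B * D = c • 1 - B) (k : Fin n) :
    eig hB k.rev = c - eig hB k := by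
  have hchar : B.charpoly = (c • 1 + (-1 : ℝ) • B).charpoly := by
    rw [neg_one_smul, ← sub_eq_add_neg, ← h, charpoly_mul_comm, ← mul_assoc, hD, one_mul]
  have hr := congrArg Polynomial.roots hchar
  rw [roots_charpoly_eq_map_eig hB, charpoly_smul_one_add_smul hB, Polynomial.roots_prod _ _
    (Finset.prod_ne_zero_iff.2 fun _ _ => Polynomial.X_sub_C_ne_zero _)] at hr
  have hm : Finset.univ.val.map (eig hB) = Finset.univ.val.map fun k : Fin n => c - eig hB k := by
    have h2 := congrArg (Multiset.map fun x : ℝ => c - x) (map_eigenvalues_eq_map_eig hB)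
    rw [Multiset.map_map, Multiset.map_map] at h2
    rw [hr]
    simp only [Polynomial.roots_X_sub_C, Multiset.bind_singleton]
    refine Eq.trans ?_ h2
    congr 1
    ext i
    simp; ring
  -- Reversing the index makes `c - eig` decreasing; two decreasing enumerations of one multiset
  -- coincide.
  have hrev : Finset.univ.val.map (fun k : Fin n => c - eig hB k) =
      Finset.univ.val.map fun k : Fin n => c - eig hB k.rev := by
    conv_lhs => rw [← Finset.map_univ_equiv (Fin.revPerm (n := n)), Finset.map_val,
      Multiset.map_map]
    rfl
  have := congrFun (Antitone.eq_of_map_univ_eq (eig_antitone hB)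
    (fun i j hij => sub_le_sub_left (eig_antitone hB (Fin.rev_le_rev.2 hij)) c)
    (hm.trans hrev)) k.rev
  simpa using this

theorem posSemidef_sub_eig_last {B : Matrix (Fin (n + 1)) (Fin (n + 1)) ℝ} (hB : B.IsHermitian) :
    (B - eig hB (Fin.last n) • 1).PosSemidef := by
  have h : B - eig hB (Fin.last n) • 1 = (-eig hB (Fin.last n)) • 1 + (1 : ℝ) • B := by
    rw [one_smul, neg_smul, sub_eq_neg_add]
  rw [h, smul_one_add_smul_eq_conj hB]
  refine PosSemidef.mul_mul_conjTranspose_same (posSemidef_diagonal_iff.2 fun i => ?_) _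
  have hi : hB.eigenvalues i ∈ Finset.univ.val.map (eig hB) := by
    rw [← map_eigenvalues_eq_map_eig]
    exact Multiset.mem_map_of_mem _ (Finset.mem_univ i)
  obtain ⟨k, -, hk⟩ := Multiset.mem_map.1 hi
  have := eig_antitone hB (Fin.le_last k)
  rw [← hk]
  linarith

end Spectrum

/-! ### Chambers, walls and angles between simple roots -/

section Reflections

variable {d m : ℕ} {G : Subgroup (O d)} {C : Set (E d)} {α : Fin m → E d}

theorem R_apply {u : E d} (hu : ‖u‖ = 1) (x : E d) : R u x = x - (2 * ⟪u, x⟫) • u := by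
  rw [R, Submodule.reflection_orthogonal_apply, Submodule.reflection_singleton_apply]
  simp [hu, two_smul, two_mul, add_smul]

theorem R_conj (g : O d) {u : E d} (hu : ‖u‖ = 1) : R (g u) = g * R u * g⁻¹ := by
  ext1 x
  have h : ⟪g u, x⟫ = ⟪u, g⁻¹ x⟫ := by
    conv_lhs => rw [← g.apply_symm_apply x, g.inner_map_map]
    rfl
  have hx : g (g⁻¹ x) = x := g.apply_symm_apply x
  change _ = g (R u (g⁻¹ x))
  rw [R_apply (by simpa using hu), R_apply hu, map_sub, map_smul, hx, h]

theorem R_smul {u : E d} {c : ℝ} (hc : c ≠ 0) : R (c • u) = R u := by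
  have h : Submodule.span ℝ {c • u} = Submodule.span ℝ {u} :=
    Submodule.span_singleton_smul_eq (IsUnit.mk0 c hc) u
  simp only [R, h]

theorem IsReflection.exists_unit {g : O d} (h : IsReflection g) : ∃ u : E d, ‖u‖ = 1 ∧ g = R u := by
  obtain ⟨u, hu, rfl⟩ := h
  exact ⟨‖u‖⁻¹ • u, norm_smul_inv_norm hu, (R_smul (by simpa using hu)).symm⟩

theorem isReflection_R {u : E d} (hu : ‖u‖ = 1) : IsReflection (R u) :=
  ⟨u, by rintro rfl; simp at hu, rfl⟩

theorem R_apply_eq_self_iff {u x : E d} (hu : ‖u‖ = 1) : R u x = x ↔ ⟪u, x⟫ = 0 := by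
  have h0 : u ≠ 0 := by rintro rfl; simp at hu
  rw [R_apply hu, sub_eq_self, smul_eq_zero]
  simp [h0]

theorem mem_mirrors_iff {x : E d} :
    x ∈ mirrors G ↔ ∃ u : E d, ‖u‖ = 1 ∧ R u ∈ G ∧ ⟪u, x⟫ = 0 := by
  constructor
  · rintro ⟨g, hg, hr, hx⟩
    obtain ⟨u, hu, rfl⟩ := hr.exists_unit
    exact ⟨u, hu, hg, (R_apply_eq_self_iff hu).1 hx⟩
  · rintro ⟨u, hu, hg, hx⟩
    exact ⟨R u, hg, isReflection_R hu, (R_apply_eq_self_iff hu).2 hx⟩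

theorem IsWeylChamber.nonempty (hC : IsWeylChamber G C) : C.Nonempty := by
  obtain ⟨x, hx, rfl⟩ := hC
  exact ⟨x, mem_connectedComponentIn hx⟩

theorem IsWeylChamber.isPreconnected (hC : IsWeylChamber G C) : IsPreconnected C := by
  obtain ⟨x, -, rfl⟩ := hC
  exact isPreconnected_connectedComponentIn

theorem IsWeylChamber.inner_ne_zero (hC : IsWeylChamber G C) {u x : E d} (hu : ‖u‖ = 1)
    (hR : R u ∈ G) (hx : x ∈ C) : ⟪u, x⟫ ≠ 0 := by
  obtain ⟨y, -, rfl⟩ := hC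
  exact fun h => connectedComponentIn_subset _ _ hx (mem_mirrors_iff.2 ⟨u, hu, hR, h⟩)

/-- A root has constant sign on the closure of a chamber. -/
theorem IsWeylChamber.inner_nonneg_or_nonpos (hC : IsWeylChamber G C) {u : E d} (hu : ‖u‖ = 1)
    (hR : R u ∈ G) : (∀ x ∈ closure C, 0 ≤ ⟪u, x⟫) ∨ (∀ x ∈ closure C, ⟪u, x⟫ ≤ 0) := by
  have hc : Continuous fun x : E d => ⟪u, x⟫ := by fun_prop
  by_contra! h
  obtain ⟨⟨x, hx, hx0⟩, y, hy, hy0⟩ := h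
  obtain ⟨x', hx', hxC⟩ := mem_closure_iff.1 hx _ (isOpen_Iio.preimage hc) hx0
  obtain ⟨y', hy', hyC⟩ := mem_closure_iff.1 hy _ (isOpen_Ioi.preimage hc) hy0
  obtain ⟨z, hz, hz0⟩ := hC.isPreconnected.intermediate_value hxC hyC hc.continuousOn
    ⟨le_of_lt hx', le_of_lt hy'⟩
  exact hC.inner_ne_zero hu hR hz hz0

theorem inner_eq_zero_of_mem_hyperplane {u x : E d} (h : x ∈ (hyperplane u : Set (E d))) :
    ⟪u, x⟫ = 0 :=
  Submodule.mem_orthogonal_singleton_iff_inner_right.1 h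

theorem IsFundamentalSystemOf.norm_eq_one (h : IsFundamentalSystemOf G C α) (i : Fin m) :
    ‖α i‖ = 1 := h.1.1 i

theorem IsFundamentalSystemOf.R_mem (h : IsFundamentalSystemOf G C α) (i : Fin m) :
    R (α i) ∈ G := h.1.2.1 i

theorem IsFundamentalSystemOf.inner_pos (h : IsFundamentalSystemOf G C α)
    (hC : IsWeylChamber G C) (i : Fin m) {x : E d} (hx : x ∈ C) : 0 < ⟪α i, x⟫ :=
  (h.2.2 i x hx).lt_of_ne' (hC.inner_ne_zero (h.norm_eq_one i) (h.R_mem i) hx)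

theorem IsFundamentalSystemOf.inner_nonneg (h : IsFundamentalSystemOf G C α)
    (i : Fin m) {x : E d} (hx : x ∈ closure C) : 0 ≤ ⟪α i, x⟫ := by
  have hc : Continuous fun x : E d => ⟪α i, x⟫ := by fun_prop
  exact closure_minimal (fun y hy => h.2.2 i y hy) (isClosed_Ici.preimage hc) hx

theorem IsPreconnected.inter_frontier_nonempty {X : Type*} [TopologicalSpace X] {s t : Set X}
    (hs : IsPreconnected s) (h1 : (s ∩ t).Nonempty) (h2 : (s ∩ tᶜ).Nonempty) :
    (s ∩ frontier t).Nonempty := by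
  by_contra hf
  have hf : ∀ p ∈ s, p ∈ closure t → p ∈ interior t := fun p hp hc =>
    by_contra fun hi => hf ⟨p, hp, hc, hi⟩
  obtain ⟨x, hx, hxt⟩ := h1
  obtain ⟨z, hz, hzt⟩ := h2
  obtain ⟨p, -, hpi, hpc⟩ := hs (interior t) (closure t)ᶜ isOpen_interior
    isClosed_closure.isOpen_compl (fun p hp => or_iff_not_imp_right.2 fun h => hf p hp (not_not.1 h))
    ⟨x, hx, hf x hx (subset_closure hxt)⟩ ⟨z, hz, fun h => hzt (interior_subset (hf z hz h))⟩
  exact hpc (interior_subset_closure hpi)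

/-- A chamber is the open cone cut out by its fundamental system. -/
theorem IsFundamentalSystemOf.mem_of_forall_pos (h : IsFundamentalSystemOf G C α)
    (hC : IsWeylChamber G C) {z : E d} (hz : ∀ i, 0 < ⟪α i, z⟫) : z ∈ C := by
  by_contra hzC
  obtain ⟨x, hx⟩ := hC.nonempty
  -- A segment leaving the chamber meets its frontier, where some simple root vanishes; yet all
  -- simple roots are positive at both endpoints.
  obtain ⟨p, hp, hpf⟩ := 
    IsPreconnected.inter_frontier_nonempty (convex_segment (𝕜 := ℝ) x z).isPreconnected
      ⟨x, left_mem_segment ℝ x z, hx⟩ ⟨z, right_mem_segment ℝ x z, hzC⟩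
  obtain ⟨i, hi⟩ := Set.mem_iUnion.1 (h.1.2.2 hpf)
  have hi := inner_eq_zero_of_mem_hyperplane hi
  obtain ⟨a, b, ha, hb, hab, rfl⟩ := hp
  have h1 := h.inner_pos hC i hx
  have h2 := hz i
  rw [inner_add_right, inner_smul_right, inner_smul_right] at hi
  rcases ha.eq_or_lt with rfl | ha
  · obtain rfl : b = 1 := by linarith
    linarith
  · nlinarith [mul_pos ha h1, mul_nonneg hb h2.le]

/-- Each wall of a chamber has a point lying on no other wall. -/
theorem IsFundamentalSystemOf.exists_wall_point (h : IsFundamentalSystemOf G C α) (i : Fin m) :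
    ∃ x ∈ closure C, ⟪α i, x⟫ = 0 ∧ ∀ j, j ≠ i → 0 < ⟪α j, x⟫ := by
  obtain _ | m := m
  · exact i.elim0
  -- By minimality of the system, the walls other than the `i`-th miss a frontier point.
  have hn : ¬ CoversBoundary G C (α ∘ i.succAbove) := fun hc => by
    have := h.2.1 _ _ hc
    omega
  have hn' : ¬ frontier C ⊆ ⋃ k, (hyperplane (α (i.succAbove k)) : Set (E d)) := fun hf =>
    hn ⟨fun k => h.norm_eq_one _, fun k => h.R_mem _, hf⟩
  obtain ⟨x, hxf, hx⟩ := Set.not_subset.1 hn'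
  have hne : ∀ j, j ≠ i → ⟪α j, x⟫ ≠ 0 := fun j hj h0 => by
    obtain ⟨k, rfl⟩ := Fin.exists_succAbove_eq hj
    exact hx (Set.mem_iUnion.2 ⟨k, Submodule.mem_orthogonal_singleton_iff_inner_right.2 h0⟩)
  have hxc := frontier_subset_closure hxf
  refine ⟨x, hxc, ?_, fun j hj => (h.inner_nonneg j hxc).lt_of_ne' (hne j hj)⟩
  obtain ⟨j, hj⟩ := Set.mem_iUnion.1 (h.1.2.2 hxf)
  have hj := inner_eq_zero_of_mem_hyperplane hj
  by_contra h0
  exact h0 ((not_imp_comm.1 (hne j) (not_not.2 hj)) ▸ hj)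

theorem R_apply_mem {u v : E d} (huG : R u ∈ G) (hv : ‖v‖ = 1) (hvG : R v ∈ G) :
    ‖R u v‖ = 1 ∧ R (R u v) ∈ G := by
  refine ⟨by simpa using hv, ?_⟩
  rw [R_conj _ hv]
  exact G.mul_mem (G.mul_mem huG hvG) (G.inv_mem huG)

/-- A root in the span of two simple roots has coefficients of equal sign. -/
theorem IsFundamentalSystemOf.coeff_mul_nonneg (h : IsFundamentalSystemOf G C α)
    (hC : IsWeylChamber G C) {i j : Fin m} (hij : i ≠ j) {a b : ℝ}
    (hn : ‖a • α i + b • α j‖ = 1) (hR : R (a • α i + b • α j) ∈ G) : 0 ≤ a * b := by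
  -- A point on wall `i` alone isolates the coefficient `b`, one on wall `j` alone isolates `a`; the
  -- root has the same weak sign at both.
  obtain ⟨x, hx, hxi, hx'⟩ := h.exists_wall_point i
  obtain ⟨y, hy, hyj, hy'⟩ := h.exists_wall_point j
  have hxj := hx' j hij.symm
  have hyi := hy' i hij
  rcases hC.inner_nonneg_or_nonpos hn hR with hs | hs
  · have h1 := hs x hx
    have h2 := hs y hy
    simp only [inner_add_left, real_inner_smul_left, hxi, hyj, mul_zero, zero_add, add_zero]
      at h1 h2
    exact mul_nonneg (nonneg_of_mul_nonneg_left h2 hyi) (nonneg_of_mul_nonneg_left h1 hxj)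
  · have h1 := hs x hx
    have h2 := hs y hy
    simp only [inner_add_left, real_inner_smul_left, hxi, hyj, mul_zero, zero_add, add_zero]
      at h1 h2
    exact mul_nonneg_of_nonpos_of_nonpos (by_contra fun hc => by nlinarith [not_le.1 hc])
      (by_contra fun hc => by nlinarith [not_le.1 hc])

/-- The root `R (α i) (α j)` has coefficient 1 on `α j`, so its coefficient on `α i` cannot be
negative. -/
theorem IsFundamentalSystemOf.inner_nonpos (h : IsFundamentalSystemOf G C α)
    (hC : IsWeylChamber G C) {i j : Fin m} (hij : i ≠ j) : ⟪α i, α j⟫ ≤ 0 := by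
  have hi := h.norm_eq_one i
  obtain ⟨hn, hR⟩ := R_apply_mem (h.R_mem i) (h.norm_eq_one j) (h.R_mem j)
  have he : R (α i) (α j) = (-(2 * ⟪α i, α j⟫)) • α i + (1 : ℝ) • α j := by
    rw [R_apply hi]; module
  rw [he] at hn hR
  have := h.coeff_mul_nonneg hC hij hn hR
  linarith

/-- The angle between two simple roots is right or at least `2π/3`. -/
theorem IsFundamentalSystemOf.inner_eq_zero_or_le (h : IsFundamentalSystemOf G C α)
    (hC : IsWeylChamber G C) {i j : Fin m} (hij : i ≠ j) :
    ⟪α i, α j⟫ = 0 ∨ ⟪α i, α j⟫ ≤ -(1 / 2) := by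
  have hi := h.norm_eq_one i
  have hj := h.norm_eq_one j
  obtain ⟨hn, hR⟩ := R_apply_mem (h.R_mem j) hi (h.R_mem i)
  obtain ⟨hn, hR⟩ := R_apply_mem (h.R_mem i) hn hR
  have hii : ⟪α i, α i⟫ = 1 := by rw [real_inner_self_eq_norm_sq, hi, one_pow]
  -- If the inner product lay strictly between -1/2 and 0, the first coefficient would be negative
  -- and the second positive.
  have he : R (α i) (R (α j) (α i)) =
      (4 * ⟪α i, α j⟫ ^ 2 - 1) • α i + (-(2 * ⟪α i, α j⟫)) • α j := by
    rw [R_apply hj, R_apply hi, inner_sub_right, inner_smul_right, hii, real_inner_comm (α i) (α j)]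
    module
  rw [he] at hn hR
  have h1 := h.coeff_mul_nonneg hC hij hn hR
  have h2 := h.inner_nonpos hC hij
  by_contra! hc
  have h3 : ⟪α i, α j⟫ < 0 := h2.lt_of_ne hc.1
  nlinarith [mul_pos (neg_pos.2 h3) (by nlinarith [hc.2] : (0 : ℝ) < 1 - 4 * ⟪α i, α j⟫ ^ 2)]

end Reflections

/-! ### Generation by simple reflections, and irreducibility -/

section Generation

variable {d m : ℕ} {G : Subgroup (O d)} {C : Set (E d)} {α : Fin m → E d}

theorem eq_inner_smul_of_orthogonal_le {u v : E d} (hu : ‖u‖ = 1)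
    (h : ∀ y, ⟪u, y⟫ = 0 → ⟪v, y⟫ = 0) : v = ⟪u, v⟫ • u := by
  have huu : ⟪u, u⟫ = 1 := by rw [real_inner_self_eq_norm_sq, hu, one_pow]
  have h1 : ⟪u, v - ⟪u, v⟫ • u⟫ = 0 := by
    rw [inner_sub_right, inner_smul_right, huu, mul_one, sub_self]
  have h2 := h _ h1
  rw [← sub_eq_zero, ← inner_self_eq_zero (𝕜 := ℝ), inner_sub_left, h2, real_inner_smul_left, h1,
    mul_zero, sub_zero]

/-- A mirror has a point lying on no other mirror. -/
theorem exists_generic_point [Finite G] {u : E d} (hu : ‖u‖ = 1) :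
    ∃ y, ⟪u, y⟫ = 0 ∧ ∀ v : E d, ‖v‖ = 1 → R v ∈ G → ⟪v, y⟫ = 0 → R v = R u := by
  by_contra! hcon
  -- A real vector space is not a finite union of proper subspaces, so some other mirror would
  -- contain all of `hyperplane u` and hence equal it.
  let p : {g : G // IsReflection (g : O d) ∧ (g : O d) ≠ R u} → Subspace ℝ (hyperplane u) :=
    fun g => (LinearMap.eqLocus (g.1.1.toLinearEquiv : E d →ₗ[ℝ] E d) LinearMap.id).comap
      (hyperplane u).subtype
  have hp : ⋃ g, (p g : Set (hyperplane u)) = Set.univ := by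
    refine Set.eq_univ_of_forall fun y => ?_
    obtain ⟨v, hv, hvG, hvy, hne⟩ :=
      hcon y (Submodule.mem_orthogonal_singleton_iff_inner_right.1 y.2)
    exact Set.mem_iUnion.2 ⟨⟨⟨R v, hvG⟩, isReflection_R hv, hne⟩, (R_apply_eq_self_iff hv).2 hvy⟩
  obtain ⟨⟨⟨g, hg⟩, hgr, hgu⟩, htop⟩ := Subspace.exists_eq_top_of_iUnion_eq_univ hp
  obtain ⟨v, hv, rfl⟩ := hgr.exists_unit
  have hvu : v = ⟪u, v⟫ • u := eq_inner_smul_of_orthogonal_le hu fun y hy => by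
    have : (⟨y, Submodule.mem_orthogonal_singleton_iff_inner_right.2 hy⟩ : hyperplane u) ∈
        p ⟨⟨R v, hg⟩, hgr, hgu⟩ := htop ▸ Submodule.mem_top
    exact (R_apply_eq_self_iff hv).1 this
  have hc : ⟪u, v⟫ ≠ 0 := fun h0 => by
    rw [h0, zero_smul] at hvu
    simp [hvu] at hv
  exact hgu ((congrArg R hvu).trans (R_smul hc))

/-- Every orbit of the group generated by the simple reflections meets the closed chamber. -/
theorem IsFundamentalSystemOf.exists_mem_closed_chamber [Finite G]
    (h : IsFundamentalSystemOf G C α) (hC : IsWeylChamber G C) (y : E d) :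
    ∃ w ∈ Subgroup.closure (Set.range fun i => R (α i)), ∀ i, 0 ≤ ⟪α i, w y⟫ := by
  obtain ⟨x, hx⟩ := hC.nonempty
  have hle : Subgroup.closure (Set.range fun i => R (α i)) ≤ G :=
    (Subgroup.closure_le _).2 (by rintro _ ⟨i, rfl⟩; exact h.R_mem i)
  have hfin : (Subgroup.closure (Set.range fun i => R (α i)) : Set (O d)).Finite :=
    (Set.toFinite (G : Set (O d))).subset hle
  -- At the maximum, reflecting `w y` in `α i` changes the pairing by `-2⟪α i, w y⟫⟪α i, x⟫ ≤ 0`,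
  -- and the last factor is positive.
  obtain ⟨w, hw, hmax⟩ := hfin.exists_maximalFor (fun w : O d => ⟪w y, x⟫) _ ⟨1, one_mem _⟩
  refine ⟨w, hw, fun i => ?_⟩
  have hwi : R (α i) * w ∈ Subgroup.closure (Set.range fun i => R (α i)) :=
    mul_mem (Subgroup.subset_closure ⟨i, rfl⟩) hw
  have h1 : ⟪R (α i) (w y), x⟫ ≤ ⟪w y, x⟫ := (le_total _ _).elim id (hmax hwi)
  rw [R_apply (h.norm_eq_one i), inner_sub_left, real_inner_smul_left] at h1
  exact nonneg_of_mul_nonneg_left (by linarith) (h.inner_pos hC i hx)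

/-- The simple reflections generate the reflection group. -/
theorem IsFundamentalSystemOf.closure_eq [Finite G] (h : IsFundamentalSystemOf G C α)
    (hC : IsWeylChamber G C) (hG : IsReflectionGroup G) :
    Subgroup.closure (Set.range fun i => R (α i)) = G := by
  have hle : Subgroup.closure (Set.range fun i => R (α i)) ≤ G :=
    (Subgroup.closure_le _).2 (by rintro _ ⟨i, rfl⟩; exact h.R_mem i)
  refine le_antisymm hle ?_
  obtain ⟨S, hS, rfl⟩ := hG
  refine (Subgroup.closure_le _).2 fun s hs => ?_
  obtain ⟨u, hu, rfl⟩ := (hS s hs).exists_unit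
  obtain ⟨y, hy, hgen⟩ := exists_generic_point (G := Subgroup.closure S) hu
  obtain ⟨w, hw, hpos⟩ := h.exists_mem_closed_chamber hC y
  have hwu : R (w u) ∈ Subgroup.closure S := by
    rw [R_conj w hu]
    exact mul_mem (mul_mem (hle hw) (Subgroup.subset_closure hs)) (inv_mem (hle hw))
  -- `w y` lies on the mirror of `R (w u)`, so it is in the closed cone but not the chamber, and
  -- some `α i` vanishes there. Pulled back by `w`, that wall passes through the generic point `y`,
  -- so it is the mirror of `u`.
  have hwy : w y ∉ C := fun hc =>
    hC.inner_ne_zero (by simpa using hu) hwu hc (by rw [w.inner_map_map, hy])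
  have hex : ∃ i, ⟪α i, w y⟫ = 0 := by
    by_contra! hne
    exact hwy (h.mem_of_forall_pos hC fun i => (hpos i).lt_of_ne' (hne i))
  obtain ⟨i, hi⟩ := hex
  have hconj : R (w⁻¹ (α i)) = w⁻¹ * R (α i) * w := by
    rw [R_conj _ (h.norm_eq_one i), inv_inv]
  have hiy : ⟪w⁻¹ (α i), y⟫ = 0 := by
    rw [← w.inner_map_map, ← hi]
    exact congrArg (fun z => ⟪z, w y⟫) (w.apply_symm_apply (α i))
  have heq := hgen (w⁻¹ (α i)) (by simpa using h.norm_eq_one i)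
    (hconj ▸ mul_mem (mul_mem (inv_mem (hle hw)) (h.R_mem i)) (hle hw)) hiy
  rw [SetLike.mem_coe, ← heq, hconj]
  exact mul_mem (mul_mem (inv_mem hw) (Subgroup.subset_closure ⟨i, rfl⟩)) hw

theorem R_commute_of_inner_eq_zero {u v : E d} (hu : ‖u‖ = 1) (hv : ‖v‖ = 1) (h : ⟪u, v⟫ = 0) :
    R u * R v = R v * R u := by
  have h1 := R_conj (R u) hv
  rw [(R_apply_eq_self_iff hu).2 h] at h1
  exact (eq_mul_inv_iff_mul_eq.1 h1).symm

theorem apply_eq_self_of_mem_closure {T : Set (E d)} (hT : ∀ u ∈ T, ‖u‖ = 1) {g : O d}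
    (hg : g ∈ Subgroup.closure (R '' T)) {x : E d} (hx : ∀ u ∈ T, ⟪u, x⟫ = 0) : g x = x := by
  induction hg using Subgroup.closure_induction with
  | mem g hg =>
    obtain ⟨u, hu, rfl⟩ := hg
    exact (R_apply_eq_self_iff (hT u hu)).2 (hx u hu)
  | one => rfl
  | mul g k _ _ hg hk => exact (congrArg g hk).trans hg
  | inv g _ hg => exact g.symm_apply_eq.2 hg.symm

theorem closure_image_R_ne_bot {T : Set (E d)} (hT : ∀ u ∈ T, ‖u‖ = 1) (hne : T.Nonempty) :
    Subgroup.closure (R '' T) ≠ ⊥ := by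
  obtain ⟨u, hu⟩ := hne
  intro hbot
  have h1 : R u = 1 := (Subgroup.mem_bot).1 (hbot ▸ Subgroup.subset_closure ⟨u, hu, rfl⟩)
  have h2 : ⟪u, u⟫ = 0 := (R_apply_eq_self_iff (hT u hu)).1 (by rw [h1]; rfl)
  have h3 := hT u hu
  rw [real_inner_self_eq_norm_sq, h3] at h2
  norm_num at h2

theorem isReflectionGroup_closure_image {T : Set (E d)} (hT : ∀ u ∈ T, ‖u‖ = 1) :
    IsReflectionGroup (Subgroup.closure (R '' T)) :=
  ⟨_, by rintro _ ⟨u, hu, rfl⟩; exact isReflection_R (hT u hu), rfl⟩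

/-- Two nonempty orthogonal sets of roots generate a reducible group. -/
theorem isReducible_closure_union {S T : Set (E d)} (hS : ∀ u ∈ S, ‖u‖ = 1)
    (hT : ∀ u ∈ T, ‖u‖ = 1) (hS' : S.Nonempty) (hT' : T.Nonempty)
    (horth : ∀ u ∈ S, ∀ v ∈ T, ⟪u, v⟫ = 0) :
    IsReducible (Subgroup.closure (R '' (S ∪ T))) := by
  refine ⟨Subgroup.closure (R '' S), Subgroup.closure (R '' T),
    isReflectionGroup_closure_image hS, isReflectionGroup_closure_image hT,
    closure_image_R_ne_bot hS hS', closure_image_R_ne_bot hT hT', ?_, ?_, ?_⟩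
  · have hle : Subgroup.closure (R '' S) ≤
        Subgroup.centralizer (Subgroup.closure (R '' T) : Set (O d)) := by
      rw [Subgroup.centralizer_closure, Subgroup.closure_le]
      rintro _ ⟨u, hu, rfl⟩
      refine Subgroup.mem_centralizer_iff.2 ?_
      rintro _ ⟨v, hv, rfl⟩
      exact (R_commute_of_inner_eq_zero (hS u hu) (hT v hv) (horth u hu v hv)).symm
    exact fun h hh k hk => (Subgroup.mem_centralizer_iff.1 (hle hh) k hk).symm
  · refine (Subgroup.eq_bot_iff_forall _).2 fun g hg => ?_
    obtain ⟨hgS, hgT⟩ := Subgroup.mem_inf.1 hg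
    -- A common element fixes the span of `S` as a product of reflections in `T`, and its complement
    -- as one in `S`.
    have hV : Submodule.span ℝ S ≤
        LinearMap.eqLocus (g.toLinearEquiv : E d →ₗ[ℝ] E d) LinearMap.id :=
      Submodule.span_le.2 fun u hu => apply_eq_self_of_mem_closure hT hgT fun v hv => by
        rw [real_inner_comm]; exact horth u hu v hv
    ext1 x
    obtain ⟨p, hp, q, hq, rfl⟩ := (Submodule.span ℝ S).exists_add_mem_mem_orthogonal x
    have h1 : g p = p := hV hp
    have h2 : g q = q := apply_eq_self_of_mem_closure hS hgS fun u hu =>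
      hq u (Submodule.subset_span hu)
    rw [map_add, h1, h2]
    rfl
  · rw [← Subgroup.closure_union, ← Set.image_union]

theorem IsFundamentalSystemOf.eq_univ_of_orthogonal [Finite G] (h : IsFundamentalSystemOf G C α)
    (hC : IsWeylChamber G C) (hG : IsReflectionGroup G) (hirr : ¬ IsReducible G)
    {s : Set (Fin m)} (hs : s.Nonempty) (horth : ∀ i ∈ s, ∀ j ∉ s, ⟪α i, α j⟫ = 0) :
    s = Set.univ := by
  by_contra hne
  refine hirr ?_
  have hu : (Set.range fun i => R (α i)) = R '' (α '' s ∪ α '' sᶜ) := by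
    rw [← Set.image_union, Set.union_compl_self, Set.image_univ, ← Set.range_comp]
    rfl
  rw [← h.closure_eq hC hG, hu]
  refine isReducible_closure_union ?_ ?_ (hs.image α)
    ((Set.nonempty_compl.2 hne).image α) ?_
  · rintro _ ⟨i, -, rfl⟩; exact h.norm_eq_one i
  · rintro _ ⟨i, -, rfl⟩; exact h.norm_eq_one i
  · rintro _ ⟨i, hi, rfl⟩ _ ⟨j, hj, rfl⟩; exact horth i hi j hj

/-- The double sum is the squared norm of a sum of simple roots, nonzero because it pairs positively
with any chamber point. -/
theorem IsFundamentalSystemOf.sum_sum_inner_pos (h : IsFundamentalSystemOf G C α)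
    (hC : IsWeylChamber G C) {s : Finset (Fin m)} (hs : s.Nonempty) :
    0 < ∑ i ∈ s, ∑ j ∈ s, ⟪α i, α j⟫ := by
  obtain ⟨x, hx⟩ := hC.nonempty
  have h1 : 0 < ⟪∑ i ∈ s, α i, x⟫ := by
    rw [sum_inner]
    exact Finset.sum_pos (fun i _ => h.inner_pos hC i hx) hs
  have h2 : ∑ i ∈ s, α i ≠ 0 := fun h0 => by simp [h0] at h1
  have h3 := real_inner_self_pos.2 h2
  rw [sum_inner] at h3
  simpa only [inner_sum] using h3

end Generation

/-! ### Two-colouring and Perron–Frobenius -/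

section Signs

open Matrix

/-- The support graph of a Gram matrix whose off-diagonal entries are `0` or at most `-1/2` is
a forest, hence two-colourable. -/
theorem exists_sign_of_sum_sum_pos {ι : Type*} [DecidableEq ι] {B : ι → ι → ℝ}
    (hdiag : ∀ i, B i i = 1) (hsymm : ∀ i j, B i j = B j i)
    (hoff : ∀ i j, i ≠ j → B i j = 0 ∨ B i j ≤ -(1 / 2))
    (hpos : ∀ s : Finset ι, s.Nonempty → 0 < ∑ i ∈ s, ∑ j ∈ s, B i j) (s : Finset ι) :
    ∃ ε : ι → ℝ, (∀ i, ε i * ε i = 1) ∧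
      ∀ i ∈ s, ∀ j ∈ s, i ≠ j → B i j ≠ 0 → ε i * ε j = -1 := by
  induction s using Finset.strongInduction with
  | H s ih =>
    rcases s.eq_empty_or_nonempty with rfl | hs
    · exact ⟨fun _ => 1, by simp⟩
    obtain ⟨i, hi, hrow⟩ : ∃ i ∈ s, 0 < ∑ j ∈ s, B i j := by
      by_contra! hc
      exact (hpos s hs).not_ge (Finset.sum_nonpos hc)
    -- Two neighbours would bring the row sum down to at most 1 - 1/2 - 1/2 = 0. So `i` is a leaf or
    -- isolated, and a colouring of the rest extends to it.
    have huniq : ∀ j ∈ s, ∀ k ∈ s, j ≠ i → k ≠ i → B i j ≠ 0 → B i k ≠ 0 → j = k := by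
      intro j hj k hk hji hki hbj hbk
      by_contra hjk
      have h1 := (hoff i j hji.symm).resolve_left hbj
      have h2 := (hoff i k hki.symm).resolve_left hbk
      have hj' : j ∈ s.erase i := Finset.mem_erase.2 ⟨hji, hj⟩
      have hk' : k ∈ (s.erase i).erase j :=
        Finset.mem_erase.2 ⟨Ne.symm hjk, Finset.mem_erase.2 ⟨hki, hk⟩⟩
      rw [← Finset.add_sum_erase _ _ hi, ← Finset.add_sum_erase _ _ hj',
        ← Finset.add_sum_erase _ _ hk', hdiag] at hrow
      have h3 : ∑ l ∈ ((s.erase i).erase j).erase k, B i l ≤ 0 :=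
        Finset.sum_nonpos fun l hl => by
          have hl : l ≠ i := (Finset.mem_erase.1 (Finset.mem_of_mem_erase
            (Finset.mem_of_mem_erase hl))).1
          rcases hoff i l hl.symm with h | h <;> linarith
      linarith
    obtain ⟨ε, hε, hadj⟩ := ih (s.erase i) (Finset.erase_ssubset hi)
    obtain ⟨c, hc, hci⟩ : ∃ c : ℝ, c * c = 1 ∧
        ∀ j ∈ s, j ≠ i → B i j ≠ 0 → c * ε j = -1 := by
      by_cases hex : ∃ j ∈ s, j ≠ i ∧ B i j ≠ 0
      · obtain ⟨j, hj, hji, hbj⟩ := hex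
        refine ⟨-ε j, by rw [neg_mul_neg, hε], fun k hk hki hbk => ?_⟩
        rw [← huniq j hj k hk hji hki hbj hbk, neg_mul, hε]
      · push Not at hex
        exact ⟨1, one_mul 1, fun j hj hji hbj => absurd (hex j hj hji) hbj⟩
    refine ⟨Function.update ε i c, fun k => ?_, fun j hj k hk hjk hb => ?_⟩
    · by_cases hk : k = i
      · rw [hk, Function.update_self, hc]
      · rw [Function.update_of_ne hk, hε]
    · by_cases hji : j = i
      · subst hji
        rw [Function.update_self, Function.update_of_ne hjk.symm]
        exact hci k hk hjk.symm hb
      · rw [Function.update_of_ne hji]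
        by_cases hki : k = i
        · subst hki
          rw [Function.update_self, mul_comm]
          exact hci j hj hji (hsymm j k ▸ hb)
        · rw [Function.update_of_ne hki]
          exact hadj j (Finset.mem_erase.2 ⟨hji, hj⟩) k (Finset.mem_erase.2 ⟨hki, hk⟩) hjk hb

theorem diagonal_conj_eq {ι : Type*} [Fintype ι] [DecidableEq ι] {B : Matrix ι ι ℝ} {ε : ι → ℝ}
    {c : ℝ} (hε : ∀ i, ε i * ε i = 1) (hdiag : ∀ i, 2 * B i i = c)
    (hadj : ∀ i j, i ≠ j → B i j ≠ 0 → ε i * ε j = -1) :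
    diagonal ε * B * diagonal ε = c • 1 - B := by
  ext i j
  rw [mul_diagonal, diagonal_mul, Matrix.sub_apply, Matrix.smul_apply, smul_eq_mul]
  by_cases hij : i = j
  · subst hij
    rw [one_apply_eq]
    linear_combination B i i * hε i + hdiag i
  · rw [one_apply_ne hij]
    by_cases hb : B i j = 0
    · simp [hb]
    · linear_combination B i j * hadj i j hij hb

theorem diagonal_mul_self_eq_one {ι : Type*} [Fintype ι] [DecidableEq ι] {ε : ι → ℝ}
    (hε : ∀ i, ε i * ε i = 1) : diagonal ε * diagonal ε = 1 := by
  rw [diagonal_mul_diagonal, ← diagonal_one]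
  exact congrArg diagonal (funext hε)

/-- Perron–Frobenius: a vector in the kernel of an irreducible positive semidefinite matrix with
nonpositive off-diagonal entries has no zero coordinate unless it vanishes. -/
theorem eq_zero_of_mulVec_eq_zero {ι : Type*} [Fintype ι] {P : Matrix ι ι ℝ}
    (hP : P.PosSemidef) (hoff : ∀ i j, i ≠ j → P i j ≤ 0)
    (hirr : ∀ s : Set ι, s.Nonempty → (∀ i ∈ s, ∀ j ∉ s, P i j = 0) → s = Set.univ)
    {x : ι → ℝ} (hx : P *ᵥ x = 0) {i : ι} (hi : x i = 0) : x = 0 := by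
  have hquad : ∀ y : ι → ℝ, y ⬝ᵥ (P *ᵥ y) = ∑ i, ∑ j, y i * (P i j * y j) := fun y => by
    simp only [dotProduct, mulVec, Finset.mul_sum]
  -- Absolute values do not increase the quadratic form, as off-diagonal entries are nonpositive;
  -- semidefiniteness then puts `|x|` in the kernel.
  have habs : P *ᵥ (fun j => |x j|) = 0 := by
    rw [← hP.dotProduct_mulVec_zero_iff]
    refine le_antisymm ?_ (hP.dotProduct_mulVec_nonneg _)
    have h0 : x ⬝ᵥ (P *ᵥ x) = 0 := by rw [hx, dotProduct_zero]
    rw [star_trivial, ← h0, hquad, hquad]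
    refine Finset.sum_le_sum fun i _ => Finset.sum_le_sum fun j _ => ?_
    by_cases hij : i = j
    · subst hij
      exact le_of_eq (by linear_combination P i i * abs_mul_abs_self (x i))
    · have h1 := mul_le_mul_of_nonpos_left (le_abs_self (x i * x j)) (hoff i j hij)
      rw [abs_mul] at h1
      linarith
  -- In a row where `x` vanishes, the terms of `P|x| = 0` are all nonpositive, hence all zero, so no
  -- entry links the zero set to its complement.
  have hs := hirr {i | x i = 0} ⟨i, hi⟩ fun i hi j hj => by
    have hrow : ∑ j, P i j * |x j| = 0 := congrFun habs i
    have hterm : ∀ j ∈ Finset.univ, P i j * |x j| ≤ 0 := fun j _ => by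
      by_cases hij : i = j
      · subst hij
        rw [show x i = 0 from hi, abs_zero, mul_zero]
      · exact mul_nonpos_of_nonpos_of_nonneg (hoff i j hij) (abs_nonneg _)
    exact (mul_eq_zero.1 ((Finset.sum_eq_zero_iff_of_nonpos hterm).1 hrow j
      (Finset.mem_univ j))).resolve_right (abs_ne_zero.2 hj)
  exact funext fun k => hs.ge (Set.mem_univ k)

/-- A kernel all of whose nonzero vectors have no zero coordinate is at most a line. -/
theorem sq_eq_sq_of_mulVec_eq_zero {ι : Type*} [Fintype ι] [Nonempty ι] {P : Matrix ι ι ℝ}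
    (hP : ∀ x : ι → ℝ, P *ᵥ x = 0 → ∀ i, x i = 0 → x = 0) {x y : ι → ℝ} (hx : P *ᵥ x = 0)
    (hy : P *ᵥ y = 0) (hx1 : ∑ i, x i ^ 2 = 1) (hy1 : ∑ i, y i ^ 2 = 1) (i : ι) :
    x i ^ 2 = y i ^ 2 := by
  -- This combination is chosen to vanish at coordinate `i`.
  have hz : y i • x - x i • y = 0 := hP _
    (by rw [mulVec_sub, mulVec_smul, mulVec_smul, hx, hy, smul_zero, smul_zero, sub_zero]) i
    (by simp [mul_comm])
  have hk : ∀ k, y i ^ 2 * x k ^ 2 = x i ^ 2 * y k ^ 2 := fun k => by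
    have h1 : y i * x k - x i * y k = 0 := congrFun hz k
    rw [← mul_pow, ← mul_pow, sub_eq_zero.1 h1]
  have hsum := Finset.sum_congr rfl fun k (_ : k ∈ Finset.univ) => hk k
  rw [← Finset.mul_sum, ← Finset.mul_sum, hx1, hy1, mul_one, mul_one] at hsum
  exact hsum.symm

theorem gram_apply {d : ℕ} (A : Matrix (Fin d) (Fin d) ℝ) (i j : Fin d) :
    gram A i j = ⟪row A i, row A j⟫ := by
  simp [gram, row, mul_apply, PiLp.inner_apply, mul_comm]

theorem mulVec_sub_smul_one_eq_zero_iff {ι : Type*} [Fintype ι] [DecidableEq ι]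
    {B : Matrix ι ι ℝ} {c : ℝ} {x : ι → ℝ} : (B - c • 1) *ᵥ x = 0 ↔ B *ᵥ x = c • x := by
  rw [sub_mulVec, smul_mulVec, one_mulVec, sub_eq_zero]

end Signs

end ReflGroup

/-! ### Assembly of the three spectral symmetries -/

open Matrix in
theorem mainTheorem3 (n : ℕ) (G : Subgroup (ReflGroup.O (n + 1))) (hfin : Finite G)
    (hrefl : ReflGroup.IsReflectionGroup G) (hess : ReflGroup.IsEssential G)
    (hirr : ¬ ReflGroup.IsReducible G)
    (A : Matrix (Fin (n + 1)) (Fin (n + 1)) ℝ)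
    (hA : ReflGroup.IsFundamentalSystem G (ReflGroup.row A)) :
    (∀ v w : EuclideanSpace ℝ (Fin (n + 1)), ‖v‖ = 1 → ‖w‖ = 1 →
      (ReflGroup.gram A).mulVec v = ReflGroup.eig (ReflGroup.gram_isHermitian A) 0 • ⇑v →
      (ReflGroup.gram A).mulVec w =
        ReflGroup.eig (ReflGroup.gram_isHermitian A) (Fin.last n) • ⇑w →
      ∀ i, v i ^ 2 = w i ^ 2) ∧
    (∀ k : Fin (n + 1), ReflGroup.eig (ReflGroup.M_isHermitian A) k.rev =
      -ReflGroup.eig (ReflGroup.M_isHermitian A) k) ∧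
    (∀ (j : Fin (n + 1)) (k : Fin n),
      ReflGroup.eig (ReflGroup.minor_isHermitian (ReflGroup.M_isHermitian A) j) k.rev =
        -ReflGroup.eig (ReflGroup.minor_isHermitian (ReflGroup.M_isHermitian A) j) k) := by
  obtain ⟨C, hC, h⟩ := hA
  have hdiag : ∀ i, ReflGroup.gram A i i = 1 := fun i => by
    rw [ReflGroup.gram_apply, real_inner_self_eq_norm_sq, h.norm_eq_one, one_pow]
  obtain ⟨ε, hε, hadj⟩ := ReflGroup.exists_sign_of_sum_sum_pos (B := ReflGroup.gram A) hdiag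
    (fun i j => by simp only [ReflGroup.gram_apply, real_inner_comm])
    (fun i j hij => by
      simpa only [ReflGroup.gram_apply] using h.inner_eq_zero_or_le hC hij)
    (fun s hs => by
      simpa only [ReflGroup.gram_apply] using h.sum_sum_inner_pos hC hs) Finset.univ
  have hadj : ∀ i j, i ≠ j → ReflGroup.gram A i j ≠ 0 → ε i * ε j = -1 := fun i j =>
    hadj i (Finset.mem_univ i) j (Finset.mem_univ j)
  have hMdiag : ∀ i, ReflGroup.M A i i = 0 := fun i => by simp [ReflGroup.M, hdiag]
  have hMadj : ∀ i j, i ≠ j → ReflGroup.M A i j ≠ 0 → ε i * ε j = -1 := fun i j hij hb =>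
    hadj i j hij (by simpa [ReflGroup.M, one_apply_ne hij] using hb)
  have hD := ReflGroup.diagonal_mul_self_eq_one hε
  have hgram : diagonal ε * ReflGroup.gram A * diagonal ε = (2 : ℝ) • 1 - ReflGroup.gram A :=
    ReflGroup.diagonal_conj_eq hε (fun i => by rw [hdiag, mul_one]) hadj
  refine ⟨fun v w hv hw hgv hgw => ?_, fun k => ?_, fun j k => ?_⟩
  -- The smallest eigenvalue is 2 minus the largest, so D sends `v` into the bottom eigenspace
  -- without changing squared coordinates.
  · have hlast := ReflGroup.eig_rev_of_conj_eq (ReflGroup.gram_isHermitian A) hD hgram 0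
    rw [Fin.rev_zero] at hlast
    have hker : ∀ x, (ReflGroup.gram A -
        ReflGroup.eig (ReflGroup.gram_isHermitian A) (Fin.last n) • 1) *ᵥ x = 0 →
        ∀ i, x i = 0 → x = 0 := fun x hx i hi =>
      ReflGroup.eq_zero_of_mulVec_eq_zero (ReflGroup.posSemidef_sub_eig_last _)
        (fun i j hij => by
          simpa [one_apply_ne hij, ReflGroup.gram_apply] using h.inner_nonpos hC hij)
        (fun s hs horth => h.eq_univ_of_orthogonal hC hrefl hirr hs fun i hi j hj => by
          have hij : i ≠ j := fun e => hj (e ▸ hi)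
          simpa [one_apply_ne hij, ReflGroup.gram_apply] using horth i hi j hj) hx hi
    have hv' : (ReflGroup.gram A -
        ReflGroup.eig (ReflGroup.gram_isHermitian A) (Fin.last n) • 1) *ᵥ
          (diagonal ε *ᵥ v) = 0 := by
      have hcomm : ReflGroup.gram A * diagonal ε =
          diagonal ε * ((2 : ℝ) • 1 - ReflGroup.gram A) := by
        rw [← hgram, ← mul_assoc, ← mul_assoc, hD, one_mul]
      rw [ReflGroup.mulVec_sub_smul_one_eq_zero_iff, mulVec_mulVec, hcomm, ← mulVec_mulVec,
        sub_mulVec, smul_mulVec, one_mulVec, hgv, ← sub_smul, mulVec_smul, hlast]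
    have hsq : ∀ i, (diagonal ε *ᵥ v) i ^ 2 = v i ^ 2 := fun i => by
      rw [mulVec_diagonal, mul_pow, sq (ε i), hε, one_mul]
    have hnorm : ∀ x : EuclideanSpace ℝ (Fin (n + 1)), ‖x‖ = 1 → ∑ i, x i ^ 2 = 1 :=
      fun x hx => by rw [← EuclideanSpace.real_norm_sq_eq, hx, one_pow]
    intro i
    rw [← hsq]
    exact ReflGroup.sq_eq_sq_of_mulVec_eq_zero hker hv'
      (ReflGroup.mulVec_sub_smul_one_eq_zero_iff.2 hgw)
      ((Finset.sum_congr rfl fun i _ => hsq i).trans (hnorm v hv)) (hnorm w hw) i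
  · have hM := ReflGroup.diagonal_conj_eq (c := 0) hε (fun i => by rw [hMdiag, mul_zero]) hMadj
    rw [ReflGroup.eig_rev_of_conj_eq _ hD hM, zero_sub]
  · have hM := ReflGroup.diagonal_conj_eq (B := ReflGroup.minor (ReflGroup.M A) j) (c := 0)
      (fun i => hε (j.succAbove i)) (fun i => by simp [ReflGroup.minor, hMdiag])
      (fun i k hik => hMadj _ _ (j.succAbove_right_injective.ne hik))
    rw [ReflGroup.eig_rev_of_conj_eq _
      (ReflGroup.diagonal_mul_self_eq_one fun i => hε (j.succAbove i)) hM, zero_sub]
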